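/- Let $n\ge 1$ and $f=\frac1n\sum_{i=1}^n g_i+h$ on $\mathbb{R}^p$, where $h:\mathbb{R}^p\to(-\infty,+\infty]$ is convex and lower semicontinuous with closed effective domain $\operatorname{dom}h$ and is strongly convex with parameter $\mu_h\ge 0$, that is, $h(y)\ge h(x)+\xi^T(y-x)+\frac{\mu_h}{2}\|y-x\|^2$ for all $x\in\operatorname{dom}h$, $\xi\in\partial h(x)$ and $y\in\mathbb{R}^p$. Let each $g_i$ be convex on $\operatorname{dom} h$ and twice differentiable on an open set containing $\operatorname{dom}h$, and let $\nabla g_i$ and $\nabla^2 g_i$ be Lipschitz continuous on $\operatorname{dom}h$ with constants $L_i>0$ and $K_i>0$, respectively (the second one in operator norm). Let $x^\star$ be a minimizer of $f$, let $x^0\in\operatorname{dom}f$, and put $L_{\max}=\max_i L_i$ and $K_{\mathrm{avg}}=\frac1n\sum_i K_i$. Let $(x^k)$ be generated by PROXTONE with exact Hessians: $\theta_{i,0}=0$ for all $i$, and for $k=0,1,2,\dots$ $$x^{k+1}=\operatorname*{arg\,min}_{x\in\mathbb{R}^p}\ \frac1n\sum_{i=1}^n\Bigl[g_i(x^{\theta_{i,k}})+(x-x^{\theta_{i,k}})^T\nabla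 g_i(x^{\theta_{i,k}})+\tfrac12(x-x^{\theta_{i,k}})^TH_k^i(x-x^{\theta_{i,k}})\Bigr]+h(x),\qquad H_k^i=\nabla^2g_i(x^{\theta_{i,k}}),$$ after which an index $j_k$ is drawn uniformly from $\{1,\dots,n\}$, independently of the earlier draws, and $\theta_{j_k,k+1}=k+1$, $\theta_{i,k+1}=\theta_{i,k}$ for $i\ne j_k$. Suppose that there are constants $m,M$ with $L_iI\preceq mI\preceq H_k^i\preceq MI$ almost surely for all $i$ and all $k\ge 0$, and that $$\rho:=\frac1n\,\frac{M+L_{\max}}{2\mu_h+m}+\Bigl(1-\frac1n\Bigr)<1 .$$ Then for every $\epsilon>0$ and $\delta\in(0,1)$, $$\Pr\bigl(\|x^{k+1}-x^\star\|\le\epsilon\bigr)\ \ge\ 1-\delta$$ for every integer $k\ge 0$ with $$k\ \ge\ \log\left(\frac{\bigl((K_{\mathrm{avg}}+2L_{\max})(M+L_{\max})+2L_{\max}(2\mu_h+m)\bigr)\,\|x^\star-x^0\|^2}{m(2\mu_h+m)\,\delta\,\epsilon}\right)\bigg/\log\left(\frac1\rho\right),$$ a condition that is void if $x^\star=x^0$.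 -/

import Mathlib

open MeasureTheory ProbabilityTheory
open scoped RealInnerProductSpace ENNReal

namespace Proxtone

/-- The effective domain `{x | F x < +∞}` of an extended-real-valued function on `ℝ^p`. -/
def effDom {p : ℕ} (F : EuclideanSpace ℝ (Fin p) → EReal) : Set (EuclideanSpace ℝ (Fin p)) :=
  {x | F x < ⊤}

/-- The convex subdifferential `∂F(x)`. -/
def subdiff {p : ℕ} (F : EuclideanSpace ℝ (Fin p) → EReal) (x : EuclideanSpace ℝ (Fin p)) :
    Set (EuclideanSpace ℝ (Fin p)) :=
  {ξ | ∀ y, F x + ((⟪ξ, y - x⟫ : ℝ) : EReal) ≤ F y}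

/-- `F` satisfies the `μ`-strong convexity inequality
`F y ≥ F x + ξᵀ(y - x) + (μ/2) ‖y - x‖²` for all `x ∈ dom F`, all `y` and all `ξ ∈ ∂F(x)`. -/
def StronglyConvex {p : ℕ} (F : EuclideanSpace ℝ (Fin p) → EReal) (μ : ℝ) : Prop :=
  ∀ x ∈ effDom F, ∀ ξ ∈ subdiff F x, ∀ y,
    F x + ((⟪ξ, y - x⟫ + μ / 2 * ‖y - x‖ ^ 2 : ℝ) : EReal) ≤ F y

/-- `h : ℝ^p → (-∞, +∞]` is convex and lower semicontinuous, and its effective domain is closed. -/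
structure IsRegularizer {p : ℕ} (h : EuclideanSpace ℝ (Fin p) → EReal) : Prop where
  ne_bot : ∀ x, h x ≠ ⊥
  lsc : LowerSemicontinuous h
  convex : ConvexOn ℝ (effDom h) (fun x => (h x).toReal)
  closed_dom : IsClosed (effDom h)

/-- The Hessian `∇²φ(x)`, as a linear operator: the derivative of the gradient. -/
noncomputable def hessian {p : ℕ} (φ : EuclideanSpace ℝ (Fin p) → ℝ)
    (x : EuclideanSpace ℝ (Fin p)) : EuclideanSpace ℝ (Fin p) →L[ℝ] EuclideanSpace ℝ (Fin p) :=
  fderiv ℝ (gradient φ) x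

/-- `φ` is convex on `D`, twice differentiable on an open set containing `D`, and on `D` its
gradient and its Hessian are Lipschitz with constants `L` and `K`. -/
structure IsSmoothLoss {p : ℕ} (φ : EuclideanSpace ℝ (Fin p) → ℝ)
    (D : Set (EuclideanSpace ℝ (Fin p))) (L K : ℝ) : Prop where
  convex : ConvexOn ℝ D φ
  smooth : ∃ U, IsOpen U ∧ D ⊆ U ∧ DifferentiableOn ℝ φ U ∧ DifferentiableOn ℝ (gradient φ) U
  lipschitz_gradient : ∀ x ∈ D, ∀ y ∈ D, ‖gradient φ x - gradient φ y‖ ≤ L * ‖x - y‖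
  lipschitz_hessian : ∀ x ∈ D, ∀ y ∈ D, ‖hessian φ x - hessian φ y‖ ≤ K * ‖x - y‖

/-- The composite objective `f = (1/n) ∑ g_i + h`. -/
noncomputable def objective {p n : ℕ} (g : Fin n → EuclideanSpace ℝ (Fin p) → ℝ)
    (h : EuclideanSpace ℝ (Fin p) → EReal) (x : EuclideanSpace ℝ (Fin p)) : EReal :=
  (((1 / (n : ℝ)) * ∑ i, g i x : ℝ) : EReal) + h x

/-- The quadratic model of `φ` at the base point `z` with curvature operator `A`. -/
noncomputable def quadModel {p : ℕ} (φ : EuclideanSpace ℝ (Fin p) → ℝ)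
    (z : EuclideanSpace ℝ (Fin p))
    (A : EuclideanSpace ℝ (Fin p) →L[ℝ] EuclideanSpace ℝ (Fin p))
    (x : EuclideanSpace ℝ (Fin p)) : ℝ :=
  φ z + ⟪x - z, gradient φ z⟫ + 1 / 2 * ⟪x - z, A (x - z)⟫

/-- One run of PROXTONE from `x0` for the sampled indices `j 0, j 1, …`:
`x k` are the iterates, `θ k i` is the time of the last update of the `i`-th model before the
`k`-th subproblem is solved, and `H k i` is the curvature operator that the `i`-th model holds
at that moment. The first model update happens after `x 1` has been computed. -/
structure IsRun {p n : ℕ} (g : Fin n → EuclideanSpace ℝ (Fin p) → ℝ)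
    (h : EuclideanSpace ℝ (Fin p) → EReal) (x0 : EuclideanSpace ℝ (Fin p)) (j : ℕ → Fin n)
    (x : ℕ → EuclideanSpace ℝ (Fin p)) (θ : ℕ → Fin n → ℕ)
    (H : ℕ → Fin n → (EuclideanSpace ℝ (Fin p) →L[ℝ] EuclideanSpace ℝ (Fin p))) : Prop where
  start : x 0 = x0
  theta_zero : ∀ i, θ 0 i = 0
  theta_succ : ∀ k i, θ (k + 1) i = if i = j k then k + 1 else θ k i
  curvature_kept : ∀ k i, i ≠ j k → H (k + 1) i = H k i
  argmin : ∀ k, IsMinOn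
    (fun y => (((1 / (n : ℝ)) * ∑ i, quadModel (g i) (x (θ k i)) (H k i) y : ℝ) : EReal) + h y)
    Set.univ (x (k + 1))

/-- The rate `ρ = (1/n) (M + L_max) / (2 μ_h + m) + (1 - 1/n)`. -/
noncomputable def rate (n : ℕ) (Lmax M m μh : ℝ) : ℝ :=
  1 / (n : ℝ) * ((M + Lmax) / (2 * μh + m)) + (1 - 1 / (n : ℝ))

end Proxtone

/-! Each subproblem is strongly convex with modulus `m + μ`, so its minimizer `u` satisfies a
quadratic growth inequality (`subproblem_growth`). Testing it at the minimizer `s` of the objective,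
and adding the strong subgradient inequality for `h` at `s` tested at `u`, gives two estimates of
`‖u - s‖` in terms of the base points `z i`. In `norm_sq_step_le` the models majorize the losses at
`u`, because `L i ≤ m`, and exceed them at `s` by at most `M / 2 * ‖z i - s‖ ^ 2`; hence `‖u - s‖ ^
2` is at most a constant times the mean of `‖z i - s‖ ^ 2`. In `norm_step_le` exact Hessians make
the gradient of the averaged model at `s` wrong only to second order, so `‖u - s‖` itself is bounded
by that mean, weighted by `K i / 2`. A base point is replaced by the new iterate with probability `1
/ n`, independently of the past, so the first estimate makes every expected squared base distance at
most `ρ ^ k * ‖xstar - x0‖ ^ 2` (`integral_refresh_le`). The second turns this into a bound on the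
expected distance of the next iterate, and Markov's inequality concludes. Expectations make sense
because subproblem minimizers are unique: the iterates are almost surely functions of finitely many
draws (`IsRun.eq_of_indices_eq`). -/

namespace Proxtone

/-! ### Calculus along segments -/

/-- First-order Taylor estimate on a convex set, for a derivative that is Lipschitz there. -/
theorem norm_taylor_remainder_le {E F : Type*} [NormedAddCommGroup E] [NormedSpace ℝ E]
    [NormedAddCommGroup F] [NormedSpace ℝ F] {f : E → F} {f' : E → E →L[ℝ] F} {D : Set E}
    {C : ℝ} (hD : Convex ℝ D) (hf : ∀ x ∈ D, HasFDerivAt f (f' x) x) {z y : E} (hz : z ∈ D)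
    (hy : y ∈ D) (hC : ∀ x ∈ D, ‖f' x - f' z‖ ≤ C * ‖x - z‖) :
    ‖f y - f z - f' z (y - z)‖ ≤ C / 2 * ‖y - z‖ ^ 2 := by
  set d := y - z with hd
  have hmem : ∀ t ∈ Set.Icc (0 : ℝ) 1, z + t • d ∈ D := fun t ht =>
    hD.add_smul_sub_mem hz hy ht
  have hderiv : ∀ t ∈ Set.Icc (0 : ℝ) 1,
      HasDerivAt (fun t : ℝ => f (z + t • d) - f z - t • f' z d)
        (f' (z + t • d) d - f' z d) t := by
    intro t ht
    have hline : HasDerivAt (fun t : ℝ => z + t • d) d t := by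
      simpa using ((hasDerivAt_id t).smul_const d).const_add z
    have h1 := (hf _ (hmem t ht)).comp_hasDerivAt t hline
    have h2 : HasDerivAt (fun t : ℝ => t • f' z d) (f' z d) t := by
      simpa using (hasDerivAt_id t).smul_const (f' z d)
    exact (h1.sub_const (f z)).sub h2
  have hB : ∀ t : ℝ, HasDerivAt (fun t : ℝ => C / 2 * ‖d‖ ^ 2 * t ^ 2) (C * ‖d‖ ^ 2 * t) t := by
    intro t
    have := (hasDerivAt_pow 2 t).const_mul (C / 2 * ‖d‖ ^ 2)
    exact this.congr_deriv (by push_cast; ring)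
  -- The remainder vanishes at `t = 0` and its speed is at most `C * ‖d‖ ^ 2 * t`. Comparing with a
  -- primitive of this bound avoids integrating `f'`.
  have key := image_norm_le_of_norm_deriv_right_le_deriv_boundary
    (f := fun t : ℝ => f (z + t • d) - f z - t • f' z d) (a := 0) (b := 1)
    (f' := fun t => f' (z + t • d) d - f' z d)
    (fun t ht => (hderiv t ht).continuousAt.continuousWithinAt)
    (fun t ht => (hderiv t ⟨ht.1, ht.2.le⟩).hasDerivWithinAt)
    (B := fun t : ℝ => C / 2 * ‖d‖ ^ 2 * t ^ 2) (B' := fun t => C * ‖d‖ ^ 2 * t)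
    (by simp) hB
    (by
      intro t ht
      have h1 := hC _ (hmem t ⟨ht.1, ht.2.le⟩)
      have h2 := (f' (z + t • d) - f' z).le_opNorm d
      rw [add_sub_cancel_left, norm_smul, Real.norm_of_nonneg ht.1] at h1
      calc ‖f' (z + t • d) d - f' z d‖ ≤ ‖f' (z + t • d) - f' z‖ * ‖d‖ := h2
        _ ≤ C * (t * ‖d‖) * ‖d‖ := by gcongr
        _ = C * ‖d‖ ^ 2 * t := by ring)
    (x := 1) (by simp)
  simpa [hd] using key

/-- A directional derivative is bounded by every upper bound of the difference quotients. -/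
theorem inner_gradient_le_of_forall_le {E : Type*} [NormedAddCommGroup E]
    [InnerProductSpace ℝ E] [CompleteSpace E] {φ : E → ℝ} {v z d : E} {a : ℝ}
    (hφ : HasGradientAt φ v z) (ha : ∀ t ∈ Set.Ioo (0 : ℝ) 1, φ (z + t • d) - φ z ≤ t * a) :
    ⟪v, d⟫ ≤ a := by
  have hline : HasDerivAt (fun t : ℝ => z + t • d) d 0 := by
    simpa using ((hasDerivAt_id (0 : ℝ)).smul_const d).const_add z
  have h1 : HasDerivAt (fun t : ℝ => φ (z + t • d)) ⟪v, d⟫ 0 := by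
    have h0 : HasFDerivAt φ (InnerProductSpace.toDual ℝ E v) (z + (0 : ℝ) • d) := by
      simpa using hφ.hasFDerivAt
    exact (h0.comp_hasDerivAt (0 : ℝ) hline).congr_deriv (by simp)
  have h2 := h1.tendsto_slope_zero_right
  refine le_of_tendsto h2 ?_
  filter_upwards [Ioo_mem_nhdsGT (zero_lt_one' ℝ)] with t ht
  have := ha t ht
  simp only [zero_add, zero_smul, add_zero, smul_eq_mul]
  rw [inv_mul_le_iff₀ ht.1]
  exact this

/-- First-order characterization of convexity. -/
theorem add_inner_le_of_convexOn {E : Type*} [NormedAddCommGroup E]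
    [InnerProductSpace ℝ E] [CompleteSpace E] {φ : E → ℝ} {D : Set E} {v z y : E}
    (hc : ConvexOn ℝ D φ) (hz : z ∈ D) (hy : y ∈ D) (hφ : HasGradientAt φ v z) :
    φ z + ⟪v, y - z⟫ ≤ φ y := by
  have := inner_gradient_le_of_forall_le (d := y - z) (a := φ y - φ z) hφ (by
    intro t ht
    have h := hc.2 hz hy (sub_nonneg.2 ht.2.le) ht.1.le (by ring)
    have e : (1 - t) • z + t • y = z + t • (y - z) := by module
    rw [e] at h
    simp only [smul_eq_mul] at h
    linarith)
  linarith

/-! ### Subgradients and smooth losses -/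

variable {p n : ℕ}

theorem IsRegularizer.coe_toReal {h : EuclideanSpace ℝ (Fin p) → EReal} (hr : IsRegularizer h)
    {x : EuclideanSpace ℝ (Fin p)} (hx : x ∈ effDom h) : (((h x).toReal : ℝ) : EReal) = h x :=
  EReal.coe_toReal (ne_of_lt hx) (hr.ne_bot x)

/-- Fermat's rule: at a minimizer of `φ + h` the vector `-∇φ` is a subgradient of `h`. -/
theorem neg_gradient_mem_subdiff {h : EuclideanSpace ℝ (Fin p) → EReal} (hr : IsRegularizer h)
    {φ : EuclideanSpace ℝ (Fin p) → ℝ} {u v : EuclideanSpace ℝ (Fin p)}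
    (hφ : HasGradientAt φ v u) (hu : u ∈ effDom h)
    (hmin : IsMinOn (fun y => (φ y : EReal) + h y) Set.univ u) : -v ∈ subdiff h u := by
  intro y
  by_cases hy : y ∈ effDom h
  · rw [← hr.coe_toReal hu, ← hr.coe_toReal hy]
    norm_cast
    have hneg : HasGradientAt (fun x => -φ x) (-v) u := by
      have := hφ.hasFDerivAt.neg
      rw [hasGradientAt_iff_hasFDerivAt, map_neg]
      exact this
    -- Minimality along the segment from `u` to `y` bounds the decrease of `φ` by the increase of
    -- `h`, which by convexity is at most `t` times its total increment.
    have := inner_gradient_le_of_forall_le (d := y - u)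
      (a := (h y).toReal - (h u).toReal) hneg (by
      intro t ht
      have hc := hr.convex.2 hu hy (sub_nonneg.2 ht.2.le) ht.1.le (by ring)
      have hw := hr.convex.1 hu hy (sub_nonneg.2 ht.2.le) ht.1.le (by ring)
      have e : (1 - t) • u + t • y = u + t • (y - u) := by module
      rw [e] at hc hw
      simp only [smul_eq_mul] at hc
      have hm := hmin (Set.mem_univ (u + t • (y - u)))
      simp only [Set.mem_ofPred_eq] at hm
      rw [← hr.coe_toReal hu, ← hr.coe_toReal hw] at hm
      norm_cast at hm
      linarith)
    linarith
  · have : h y = ⊤ := by simpa [effDom] using hy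
    rw [this]
    exact le_top

/-- A minimizer of `φ + h` with `φ` real-valued lies in the effective domain of `h`. -/
theorem mem_effDom_of_isMinOn {h : EuclideanSpace ℝ (Fin p) → EReal}
    {φ : EuclideanSpace ℝ (Fin p) → ℝ} {u x0 : EuclideanSpace ℝ (Fin p)} (h0 : x0 ∈ effDom h)
    (hmin : IsMinOn (fun y => (φ y : EReal) + h y) Set.univ u) : u ∈ effDom h := by
  have hm := hmin (Set.mem_univ x0)
  simp only [Set.mem_ofPred_eq] at hm
  have h1 : (φ x0 : EReal) + h x0 < ⊤ := EReal.add_lt_top (EReal.coe_ne_top _) (ne_of_lt h0)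
  by_contra hu
  have : h u = ⊤ := by simpa [effDom] using hu
  rw [this, EReal.coe_add_top] at hm
  exact absurd (hm.trans_lt h1) (lt_irrefl _)

theorem IsSmoothLoss.hasGradientAt {φ : EuclideanSpace ℝ (Fin p) → ℝ}
    {D : Set (EuclideanSpace ℝ (Fin p))} {L K : ℝ} (hφ : IsSmoothLoss φ D L K)
    {x : EuclideanSpace ℝ (Fin p)} (hx : x ∈ D) : HasGradientAt φ (gradient φ x) x := by
  obtain ⟨U, hU, hDU, h1, -⟩ := hφ.smooth
  exact ((h1 x (hDU hx)).differentiableAt (hU.mem_nhds (hDU hx))).hasGradientAt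

theorem IsSmoothLoss.hasFDerivAt_gradient {φ : EuclideanSpace ℝ (Fin p) → ℝ}
    {D : Set (EuclideanSpace ℝ (Fin p))} {L K : ℝ} (hφ : IsSmoothLoss φ D L K)
    {x : EuclideanSpace ℝ (Fin p)} (hx : x ∈ D) :
    HasFDerivAt (gradient φ) (hessian φ x) x := by
  obtain ⟨U, hU, hDU, -, h2⟩ := hφ.smooth
  exact ((h2 x (hDU hx)).differentiableAt (hU.mem_nhds (hDU hx))).hasFDerivAt

/-- The descent lemma. -/
theorem IsSmoothLoss.le_quadratic {φ : EuclideanSpace ℝ (Fin p) → ℝ}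
    {D : Set (EuclideanSpace ℝ (Fin p))} {L K : ℝ} (hφ : IsSmoothLoss φ D L K)
    {z y : EuclideanSpace ℝ (Fin p)} (hz : z ∈ D) (hy : y ∈ D) :
    φ y ≤ φ z + ⟪y - z, gradient φ z⟫ + L / 2 * ‖y - z‖ ^ 2 := by
  have := norm_taylor_remainder_le (f := φ) (C := L)
    (f' := fun x => InnerProductSpace.toDual ℝ _ (gradient φ x)) hφ.convex.1
    (fun x hx => (hφ.hasGradientAt hx).hasFDerivAt) hz hy (fun x hx => by
      rw [← map_sub, LinearIsometryEquiv.norm_map]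
      exact hφ.lipschitz_gradient x hx z hz)
  rw [Real.norm_eq_abs, InnerProductSpace.toDual_apply_apply, real_inner_comm] at this
  linarith [(abs_le.1 this).2]

/-- The Newton model of the gradient has a quadratic error. -/
theorem IsSmoothLoss.norm_gradient_sub_le {φ : EuclideanSpace ℝ (Fin p) → ℝ}
    {D : Set (EuclideanSpace ℝ (Fin p))} {L K : ℝ} (hφ : IsSmoothLoss φ D L K)
    {z y : EuclideanSpace ℝ (Fin p)} (hz : z ∈ D) (hy : y ∈ D) :
    ‖gradient φ y - gradient φ z - hessian φ z (y - z)‖ ≤ K / 2 * ‖y - z‖ ^ 2 :=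
  norm_taylor_remainder_le hφ.convex.1 (fun _ hx => hφ.hasFDerivAt_gradient hx) hz hy
    (fun x hx => hφ.lipschitz_hessian x hx z hz)

/-! ### Quadratic models and their subproblems -/

/-- Second-order expansion of the quadratic model around an arbitrary point. -/
theorem quadModel_eq (φ : EuclideanSpace ℝ (Fin p) → ℝ) (z u y : EuclideanSpace ℝ (Fin p))
    {A : EuclideanSpace ℝ (Fin p) →L[ℝ] EuclideanSpace ℝ (Fin p)}
    (hA : (A : EuclideanSpace ℝ (Fin p) →ₗ[ℝ] EuclideanSpace ℝ (Fin p)).IsSymmetric) :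
    quadModel φ z A y = quadModel φ z A u + ⟪gradient φ z + A (u - z), y - u⟫
      + 1 / 2 * ⟪y - u, A (y - u)⟫ := by
  have e : y - z = (y - u) + (u - z) := by abel
  have hs : ⟪A (u - z), y - u⟫ = ⟪u - z, A (y - u)⟫ := hA (u - z) (y - u)
  have hs' : ⟪y - u, A (u - z)⟫ = ⟪A (u - z), y - u⟫ := real_inner_comm _ _
  have hs'' : ⟪y - u, gradient φ z⟫ = ⟪gradient φ z, y - u⟫ := real_inner_comm _ _
  unfold quadModel
  rw [e, map_add]
  simp only [inner_add_left, inner_add_right]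
  rw [hs', hs'', ← hs]
  ring

/-- Once the model is recentred at `u`, its quadratic part has zero derivative there and the linear
coefficient is the gradient. -/
theorem hasGradientAt_quadModel (φ : EuclideanSpace ℝ (Fin p) → ℝ)
    (z u : EuclideanSpace ℝ (Fin p))
    {A : EuclideanSpace ℝ (Fin p) →L[ℝ] EuclideanSpace ℝ (Fin p)}
    (hA : (A : EuclideanSpace ℝ (Fin p) →ₗ[ℝ] EuclideanSpace ℝ (Fin p)).IsSymmetric) :
    HasGradientAt (quadModel φ z A) (gradient φ z + A (u - z)) u := by
  have h1 : HasFDerivAt (fun y : EuclideanSpace ℝ (Fin p) => y - u)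
      (ContinuousLinearMap.id ℝ _) u := (hasFDerivAt_id u).sub_const u
  have h2 := (h1.inner ℝ (A.hasFDerivAt.comp u h1)).const_mul (1 / 2 : ℝ)
  have h3 := ((InnerProductSpace.toDual ℝ _ (gradient φ z + A (u - z))).hasFDerivAt.comp u
    h1).const_add (quadModel φ z A u)
  rw [hasGradientAt_iff_hasFDerivAt]
  have h4 := h3.add h2
  refine (h4.congr_of_eventuallyEq (Filter.Eventually.of_forall fun y => ?_)).congr_fderiv ?_
  · simpa only [Pi.add_apply, Function.comp_apply, InnerProductSpace.toDual_apply_apply]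
      using quadModel_eq φ z u y hA
  · ext w
    simp

theorem hasGradientAt_average {E : Type*} [NormedAddCommGroup E]
    [InnerProductSpace ℝ E] [CompleteSpace E] {c : ℝ} {φ : Fin n → E → ℝ} {v : Fin n → E}
    {x : E} (hφ : ∀ i, HasGradientAt (φ i) (v i) x) :
    HasGradientAt (fun y => c * ∑ i, φ i y) (c • ∑ i, v i) x := by
  rw [hasGradientAt_iff_hasFDerivAt]
  have := (HasFDerivAt.fun_sum (u := Finset.univ)
    fun i _ => (hφ i).hasFDerivAt).const_mul c
  simpa using this

/-- The Loewner order compares operators through a positive, hence symmetric, difference; so the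
lower bound already yields symmetry and no symmetry of second derivatives is needed. -/
theorem isSymmetric_of_smul_id_le {E : Type*} [NormedAddCommGroup E]
    [InnerProductSpace ℝ E] {m : ℝ} {A : E →L[ℝ] E}
    (hA : m • ContinuousLinearMap.id ℝ E ≤ A) : (A : E →ₗ[ℝ] E).IsSymmetric := by
  have h := ((ContinuousLinearMap.le_def _ _).1 hA).isSymmetric
  intro x y
  have := h x y
  simp [inner_sub_left, inner_sub_right, inner_smul_left, inner_smul_right] at this
  simpa using this

theorem smul_norm_sq_le_inner {E : Type*} [NormedAddCommGroup E]
    [InnerProductSpace ℝ E] {m : ℝ} {A : E →L[ℝ] E}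
    (hA : m • ContinuousLinearMap.id ℝ E ≤ A) (d : E) : m * ‖d‖ ^ 2 ≤ ⟪d, A d⟫ := by
  have h := ((ContinuousLinearMap.le_def _ _).1 hA).inner_nonneg_right d
  simp [inner_sub_right, inner_smul_right] at h
  simpa using h

theorem inner_le_smul_norm_sq {E : Type*} [NormedAddCommGroup E]
    [InnerProductSpace ℝ E] {M : ℝ} {A : E →L[ℝ] E}
    (hA : A ≤ M • ContinuousLinearMap.id ℝ E) (d : E) : ⟪d, A d⟫ ≤ M * ‖d‖ ^ 2 := by
  have h := ((ContinuousLinearMap.le_def _ _).1 hA).inner_nonneg_right d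
  simp [inner_sub_right, inner_smul_right] at h
  simpa using h

theorem le_average {c : ℝ} (hn : 1 ≤ n) {a : Fin n → ℝ} (ha : ∀ i, c ≤ a i) :
    c ≤ 1 / (n : ℝ) * ∑ i, a i := by
  have hn' : (0 : ℝ) < n := by exact_mod_cast hn
  have : (n : ℝ) * c ≤ ∑ i, a i := by
    simpa using Finset.card_nsmul_le_sum Finset.univ a c (fun i _ => ha i)
  rw [one_div, ← div_eq_inv_mul, le_div_iff₀ hn']
  linarith

variable {g : Fin n → EuclideanSpace ℝ (Fin p) → ℝ} {h : EuclideanSpace ℝ (Fin p) → EReal}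
  {z : Fin n → EuclideanSpace ℝ (Fin p)}
  {A : Fin n → EuclideanSpace ℝ (Fin p) →L[ℝ] EuclideanSpace ℝ (Fin p)}
  {u : EuclideanSpace ℝ (Fin p)} {m μ : ℝ}

theorem average_quadModel_eq {y : EuclideanSpace ℝ (Fin p)}
    (hA : ∀ i, (A i : EuclideanSpace ℝ (Fin p) →ₗ[ℝ] EuclideanSpace ℝ (Fin p)).IsSymmetric) :
    (1 / (n : ℝ)) * ∑ i, quadModel (g i) (z i) (A i) y
      = (1 / (n : ℝ)) * ∑ i, quadModel (g i) (z i) (A i) u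
        + ⟪(1 / (n : ℝ)) • ∑ i, (gradient (g i) (z i) + A i (u - z i)), y - u⟫
        + 1 / 2 * (1 / (n : ℝ) * ∑ i, ⟪y - u, A i (y - u)⟫) := by
  rw [Finset.sum_congr rfl fun i _ => quadModel_eq (g i) (z i) u y (hA i), inner_smul_left,
    sum_inner, Finset.sum_add_distrib, Finset.sum_add_distrib, ← Finset.mul_sum,
    RCLike.conj_to_real]
  ring

/-- Quadratic growth of the PROXTONE subproblem at its minimizer. -/
theorem subproblem_growth (hn : 1 ≤ n) (hr : IsRegularizer h) (hsc : StronglyConvex h μ)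
    (hA : ∀ i, m • ContinuousLinearMap.id ℝ (EuclideanSpace ℝ (Fin p)) ≤ A i)
    (hu : u ∈ effDom h)
    (hmin : IsMinOn
      (fun y => (((1 / (n : ℝ)) * ∑ i, quadModel (g i) (z i) (A i) y : ℝ) : EReal) + h y)
      Set.univ u) {y : EuclideanSpace ℝ (Fin p)} (hy : y ∈ effDom h) :
    (1 / (n : ℝ)) * ∑ i, quadModel (g i) (z i) (A i) u + (h u).toReal
        + (m + μ) / 2 * ‖y - u‖ ^ 2
      ≤ (1 / (n : ℝ)) * ∑ i, quadModel (g i) (z i) (A i) y + (h y).toReal := by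
  have hs := fun i => isSymmetric_of_smul_id_le (hA i)
  have hgrad := hasGradientAt_average (c := 1 / (n : ℝ))
    fun i => hasGradientAt_quadModel (g i) (z i) u (hs i)
  have h1 := hsc u hu _ (neg_gradient_mem_subdiff hr hgrad hu hmin) y
  rw [← hr.coe_toReal hu, ← hr.coe_toReal hy] at h1
  norm_cast at h1
  have h2 := le_average hn fun i => smul_norm_sq_le_inner (hA i) (y - u)
  have h3 := average_quadModel_eq (g := g) (z := z) (u := u) (y := y) hs
  rw [inner_neg_left] at h1
  rw [h3]
  linarith

/-- Two minimizers tested against each other in the growth inequality must coincide. This is what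
makes a run a function of its indices. -/
theorem subproblem_argmin_unique (hn : 1 ≤ n) (hr : IsRegularizer h) (hsc : StronglyConvex h μ)
    (hμ : 0 ≤ μ) (hm : 0 < m)
    (hA : ∀ i, m • ContinuousLinearMap.id ℝ (EuclideanSpace ℝ (Fin p)) ≤ A i)
    {x0 u' : EuclideanSpace ℝ (Fin p)} (h0 : x0 ∈ effDom h)
    (hmin : IsMinOn
      (fun y => (((1 / (n : ℝ)) * ∑ i, quadModel (g i) (z i) (A i) y : ℝ) : EReal) + h y)
      Set.univ u)
    (hmin' : IsMinOn
      (fun y => (((1 / (n : ℝ)) * ∑ i, quadModel (g i) (z i) (A i) y : ℝ) : EReal) + h y)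
      Set.univ u') : u = u' := by
  have hu := mem_effDom_of_isMinOn h0 hmin
  have hu' := mem_effDom_of_isMinOn h0 hmin'
  have h1 := subproblem_growth hn hr hsc hA hu hmin hu'
  have h2 := subproblem_growth hn hr hsc hA hu' hmin' hu
  rw [norm_sub_rev] at h1
  have h3 : (m + μ) / 2 * ‖u - u'‖ ^ 2 ≤ 0 := by linarith
  have h4 : ‖u - u'‖ ^ 2 ≤ 0 := by
    by_contra! h5
    have : 0 < (m + μ) / 2 * ‖u - u'‖ ^ 2 := by positivity
    linarith
  have h5 : ‖u - u'‖ = 0 := by nlinarith [norm_nonneg (u - u')]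
  exact sub_eq_zero.1 (norm_eq_zero.1 h5)

/-! ### One-step estimates -/

variable {L K : Fin n → ℝ} {M : ℝ} {s : EuclideanSpace ℝ (Fin p)}

/-- The subgradient inequality for `h` at a minimizer of the objective. -/
theorem objective_minimizer_growth (hr : IsRegularizer h) (hsc : StronglyConvex h μ)
    (hg : ∀ i, IsSmoothLoss (g i) (effDom h) (L i) (K i)) (hs : s ∈ effDom h)
    (hmin : IsMinOn (objective g h) Set.univ s)
    {y : EuclideanSpace ℝ (Fin p)} (hy : y ∈ effDom h) :
    (h s).toReal - ⟪(1 / (n : ℝ)) • ∑ i, gradient (g i) s, y - s⟫ + μ / 2 * ‖y - s‖ ^ 2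
      ≤ (h y).toReal := by
  have hgrad := hasGradientAt_average (c := 1 / (n : ℝ)) fun i => (hg i).hasGradientAt hs
  have h1 := hsc s hs _ (neg_gradient_mem_subdiff hr hgrad hs hmin) y
  rw [← hr.coe_toReal hs, ← hr.coe_toReal hy] at h1
  norm_cast at h1
  rw [inner_neg_left] at h1
  linarith

/-- One iteration: the squared distance to the minimizer against those of the base points. -/
theorem norm_sq_step_le (hn : 1 ≤ n) (hr : IsRegularizer h) (hsc : StronglyConvex h μ)
    (hg : ∀ i, IsSmoothLoss (g i) (effDom h) (L i) (K i)) (hLm : ∀ i, L i ≤ m)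
    (hA : ∀ i, m • ContinuousLinearMap.id ℝ (EuclideanSpace ℝ (Fin p)) ≤ A i)
    (hAM : ∀ i, A i ≤ M • ContinuousLinearMap.id ℝ (EuclideanSpace ℝ (Fin p)))
    (hs : s ∈ effDom h) (hsmin : IsMinOn (objective g h) Set.univ s)
    (hz : ∀ i, z i ∈ effDom h) (hu : u ∈ effDom h)
    (hmin : IsMinOn
      (fun y => (((1 / (n : ℝ)) * ∑ i, quadModel (g i) (z i) (A i) y : ℝ) : EReal) + h y)
      Set.univ u) :
    (2 * μ + m) * ‖u - s‖ ^ 2 ≤ M * (1 / (n : ℝ) * ∑ i, ‖z i - s‖ ^ 2) := by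
  have h1 := subproblem_growth hn hr hsc hA hu hmin hs
  have h2 := objective_minimizer_growth hr hsc hg hs hsmin hu
  have hn0 : (0 : ℝ) ≤ 1 / (n : ℝ) := by positivity
  have h3 : (1 / (n : ℝ)) * ∑ i, (g i s + ⟪gradient (g i) s, u - s⟫)
      ≤ (1 / (n : ℝ)) * ∑ i, g i u := by
    gcongr with i
    exact add_inner_le_of_convexOn (hg i).convex hs hu ((hg i).hasGradientAt hs)
  have h4 : (1 / (n : ℝ)) * ∑ i, g i u
      ≤ (1 / (n : ℝ)) * ∑ i, quadModel (g i) (z i) (A i) u := by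
    gcongr with i
    have a := (hg i).le_quadratic (hz i) hu
    have b := smul_norm_sq_le_inner (hA i) (u - z i)
    have c : L i * ‖u - z i‖ ^ 2 ≤ m * ‖u - z i‖ ^ 2 := by gcongr; exact hLm i
    unfold quadModel
    linarith
  have h5 : (1 / (n : ℝ)) * ∑ i, quadModel (g i) (z i) (A i) s
      ≤ (1 / (n : ℝ)) * ∑ i, (g i s + M / 2 * ‖z i - s‖ ^ 2) := by
    gcongr with i
    have a := add_inner_le_of_convexOn (hg i).convex (hz i) hs ((hg i).hasGradientAt (hz i))
    have b := inner_le_smul_norm_sq (hAM i) (s - z i)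
    rw [real_inner_comm] at a
    rw [norm_sub_rev (z i)]
    unfold quadModel
    linarith
  simp only [Finset.sum_add_distrib, ← Finset.mul_sum, mul_add] at h3 h5
  rw [inner_smul_left, sum_inner, RCLike.conj_to_real] at h2
  rw [norm_sub_rev s u] at h1
  linarith

/-- One iteration: the distance to the minimizer is quadratically small. -/
theorem norm_step_le (hn : 1 ≤ n) (hr : IsRegularizer h) (hsc : StronglyConvex h μ)
    (hg : ∀ i, IsSmoothLoss (g i) (effDom h) (L i) (K i))
    (hH : ∀ i, A i = hessian (g i) (z i))
    (hA : ∀ i, m • ContinuousLinearMap.id ℝ (EuclideanSpace ℝ (Fin p)) ≤ A i)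
    (hs : s ∈ effDom h) (hsmin : IsMinOn (objective g h) Set.univ s)
    (hz : ∀ i, z i ∈ effDom h) (hu : u ∈ effDom h)
    (hmin : IsMinOn
      (fun y => (((1 / (n : ℝ)) * ∑ i, quadModel (g i) (z i) (A i) y : ℝ) : EReal) + h y)
      Set.univ u) :
    (m + μ) * ‖u - s‖ ≤ 1 / (n : ℝ) * ∑ i, K i / 2 * ‖z i - s‖ ^ 2 := by
  have hn0 : (0 : ℝ) ≤ 1 / (n : ℝ) := by positivity
  have hS := fun i => isSymmetric_of_smul_id_le (hA i)
  have h1 := subproblem_growth hn hr hsc hA hu hmin hs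
  have h2 := objective_minimizer_growth hr hsc hg hs hsmin hu
  have h3 := le_average hn fun i => smul_norm_sq_le_inner (hA i) (u - s)
  have h4 := average_quadModel_eq (g := g) (z := z) (u := s) (y := u) hS
  -- `w` is the gradient of the averaged loss at `s` minus that of the averaged model there.
  set w := (1 / (n : ℝ)) • ∑ i, (gradient (g i) s - gradient (g i) (z i)
    - hessian (g i) (z i) (s - z i)) with hw
  have hwle : ‖w‖ ≤ 1 / (n : ℝ) * ∑ i, K i / 2 * ‖z i - s‖ ^ 2 := by
    rw [hw, norm_smul, Real.norm_of_nonneg hn0]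
    gcongr
    refine (norm_sum_le _ _).trans (Finset.sum_le_sum fun i _ => ?_)
    rw [norm_sub_rev (z i)]
    exact (hg i).norm_gradient_sub_le (hz i) hs
  have h5 : ⟪w, u - s⟫ = ⟪(1 / (n : ℝ)) • ∑ i, gradient (g i) s, u - s⟫
      - ⟪(1 / (n : ℝ)) • ∑ i, (gradient (g i) (z i) + A i (s - z i)), u - s⟫ := by
    rw [← inner_sub_left, ← smul_sub, ← Finset.sum_sub_distrib, hw]
    simp only [hH, sub_sub]
  have h6 := real_inner_le_norm w (u - s)
  rw [norm_sub_rev s u] at h1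
  -- The coefficient collects `(m + μ) / 2` from the growth at `u`, `m / 2` from expanding the model
  -- around `s`, and `μ / 2` from `h` at `s`.
  have h7 : (m + μ) * ‖u - s‖ * ‖u - s‖ ≤ ‖w‖ * ‖u - s‖ := by nlinarith
  rcases (norm_nonneg (u - s)).eq_or_lt with h8 | h8
  · rw [← h8, mul_zero]
    exact (norm_nonneg w).trans hwle
  · exact (le_of_mul_le_mul_right h7 h8).trans hwle

end Proxtone

namespace Proxtone

/-! ### Runs are determined by their indices -/

section Run

variable {p n : ℕ} {g : Fin n → EuclideanSpace ℝ (Fin p) → ℝ}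
  {h : EuclideanSpace ℝ (Fin p) → EReal} {x0 : EuclideanSpace ℝ (Fin p)} {m μ : ℝ}
  {j j' : ℕ → Fin n} {x x' : ℕ → EuclideanSpace ℝ (Fin p)} {θ θ' : ℕ → Fin n → ℕ}
  {H H' : ℕ → Fin n → (EuclideanSpace ℝ (Fin p) →L[ℝ] EuclideanSpace ℝ (Fin p))}

theorem IsRun.mem_effDom (hrun : IsRun g h x0 j x θ H) (h0 : x0 ∈ effDom h) (k : ℕ) :
    x k ∈ effDom h := by
  cases k with
  | zero => rw [hrun.start]; exact h0
  | succ k => exact mem_effDom_of_isMinOn h0 (hrun.argmin k)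

theorem IsRun.theta_le (hrun : IsRun g h x0 j x θ H) (k : ℕ) (i : Fin n) : θ k i ≤ k := by
  induction k with
  | zero => rw [hrun.theta_zero]
  | succ k ih =>
    rw [hrun.theta_succ]
    split_ifs
    · exact le_rfl
    · exact ih.trans k.le_succ

/-- A run with exact, uniformly positive definite Hessians is determined by its indices. -/
theorem IsRun.eq_of_indices_eq (hn : 1 ≤ n) (hr : IsRegularizer h) (hsc : StronglyConvex h μ)
    (hμ : 0 ≤ μ) (hm : 0 < m) (h0 : x0 ∈ effDom h)
    (hrun : IsRun g h x0 j x θ H) (hrun' : IsRun g h x0 j' x' θ' H')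
    (hH : ∀ k i, H k i = hessian (g i) (x (θ k i)))
    (hH' : ∀ k i, H' k i = hessian (g i) (x' (θ' k i)))
    (hlow : ∀ k i, m • ContinuousLinearMap.id ℝ (EuclideanSpace ℝ (Fin p)) ≤ H k i)
    (k : ℕ) (hj : ∀ l < k, j l = j' l) :
    θ k = θ' k ∧ ∀ l ≤ k + 1, x l = x' l := by
  have hnext : ∀ k, θ k = θ' k → (∀ l ≤ k, x l = x' l) → ∀ l ≤ k + 1, x l = x' l := by
    intro k hθ hx l hl
    rcases Nat.le_succ_iff.1 hl with hl | rfl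
    · exact hx l hl
    · have hz : ∀ i, x' (θ' k i) = x (θ k i) := fun i => by
        rw [← hθ, hx _ (hrun.theta_le k i)]
      have hmin' := hrun'.argmin k
      simp only [hH', hz] at hmin'
      simp only [← hH] at hmin'
      exact subproblem_argmin_unique hn hr hsc hμ hm (hlow k) h0 (hrun.argmin k) hmin'
  induction k with
  | zero =>
    have hθ : θ 0 = θ' 0 := funext fun i => by rw [hrun.theta_zero, hrun'.theta_zero]
    refine ⟨hθ, hnext 0 hθ fun l hl => ?_⟩
    rw [Nat.le_zero.1 hl, hrun.start, hrun'.start]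
  | succ k ih =>
    obtain ⟨h1, h2⟩ := ih fun l hl => hj l (hl.trans k.lt_succ_self)
    have hθ : θ (k + 1) = θ' (k + 1) := funext fun i => by
      rw [hrun.theta_succ, hrun'.theta_succ, hj k k.lt_succ_self, h1]
    exact ⟨hθ, hnext _ hθ h2⟩

end Run

/-! ### Random indices and expectations -/

section History

variable {n : ℕ} {Ω : Type*}

/-- The indices drawn before time `k`. -/
def history (J : ℕ → Ω → Fin n) (k : ℕ) (ω : Ω) : Finset.range k → Fin n := fun l => J l ω

/-- `f` is almost surely a function of the indices drawn before time `k`. -/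
def IsAdapted [MeasurableSpace Ω] (P : Measure Ω) (J : ℕ → Ω → Fin n) (k : ℕ) (f : Ω → ℝ) :
    Prop :=
  ∃ F : (Finset.range k → Fin n) → ℝ, f =ᵐ[P] fun ω => F (history J k ω)

/-- Choose one representative in `S` for each value that `π` takes on `S`. -/
theorem exists_factor_on {ι α : Type*} [Nonempty α] (S : Set Ω) (π : Ω → ι) (f : Ω → α)
    (hf : ∀ ω ∈ S, ∀ ω' ∈ S, π ω = π ω' → f ω = f ω') : ∃ F : ι → α, ∀ ω ∈ S, f ω = F (π ω) := by
  classical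
  refine ⟨fun a => if ha : ∃ ω ∈ S, π ω = a then f ha.choose else Classical.arbitrary α,
    fun ω hω => ?_⟩
  have ha : ∃ ω' ∈ S, π ω' = π ω := ⟨ω, hω, rfl⟩
  simp only [dif_pos ha]
  exact hf ω hω _ ha.choose_spec.1 ha.choose_spec.2.symm

variable [MeasurableSpace Ω] {P : Measure Ω} {J : ℕ → Ω → Fin n}

theorem measurable_history (hJ : ∀ k, Measurable (J k)) (k : ℕ) : Measurable (history J k) :=
  measurable_pi_lambda _ fun l => hJ l

/-- The iterates are not assumed measurable; dependence on finitely many finite-valued draws, up to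
a null set, supplies integrability. -/
theorem isAdapted_of_determined {k : ℕ} {f : Ω → ℝ} {S : Set Ω} (hS : ∀ᵐ ω ∂P, ω ∈ S)
    (hf : ∀ ω ∈ S, ∀ ω' ∈ S, (∀ l < k, J l ω = J l ω') → f ω = f ω') : IsAdapted P J k f := by
  obtain ⟨F, hF⟩ := exists_factor_on S (history J k) f fun ω hω ω' hω' hh =>
    hf ω hω ω' hω' fun l hl => congrFun hh ⟨l, Finset.mem_range.2 hl⟩
  exact ⟨F, hS.mono hF⟩

variable [IsProbabilityMeasure P]

theorem integrable_comp_history (hJ : ∀ k, Measurable (J k)) (k : ℕ)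
    (F : (Finset.range k → Fin n) → ℝ) : Integrable (fun ω => F (history J k ω)) P := by
  have hm := measurable_history hJ k
  exact (Integrable.of_finite (f := F) (μ := P.map (history J k))).comp_measurable hm

theorem IsAdapted.integrable {k : ℕ} {f : Ω → ℝ} (hJ : ∀ k, Measurable (J k))
    (hf : IsAdapted P J k f) : Integrable f P := by
  obtain ⟨F, hF⟩ := hf
  exact (integrable_comp_history hJ k F).congr hF.symm

/-- Drawing the index `J k` is independent of the past and uniform. -/
theorem integral_ite_index (hJ : ∀ k, Measurable (J k)) (hindep : iIndepFun J P)
    (hunif : ∀ k i, P {ω | J k ω = i} = (n : ℝ≥0∞)⁻¹) {k : ℕ} {a b : Ω → ℝ}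
    (ha : IsAdapted P J k a) (hb : IsAdapted P J k b) (i : Fin n) :
    ∫ ω, (if i = J k ω then a ω else b ω) ∂P
      = 1 / (n : ℝ) * ∫ ω, a ω ∂P + (1 - 1 / (n : ℝ)) * ∫ ω, b ω ∂P := by
  classical
  have hai := ha.integrable hJ
  have hbi := hb.integrable hJ
  obtain ⟨A, hA⟩ := ha
  obtain ⟨B, hB⟩ := hb
  -- The conditional is `(a - b) * u (J k) + b`, where the first factor depends on the past and the
  -- second on the new draw.
  set u : Fin n → ℝ := fun l => if i = l then 1 else 0 with hu
  have hind : IndepFun (fun ω => (A - B) (history J k ω)) (fun ω => u (J k ω)) P := by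
    have h1 := hindep.indepFun_finset (Finset.range k) {k} (by simp) hJ
    exact h1.comp (φ := A - B) (ψ := fun y => u (y ⟨k, Finset.mem_singleton_self k⟩))
      (measurable_of_finite _) (measurable_of_finite _)
  have hui : ∫ ω, u (J k ω) ∂P = 1 / (n : ℝ) := by
    have hset : MeasurableSet {ω | J k ω = i} := hJ k (measurableSet_singleton i)
    have : (fun ω => u (J k ω)) = Set.indicator {ω | J k ω = i} 1 := by
      ext ω
      simp [hu, Set.indicator_apply, eq_comm]
    rw [this, integral_indicator_one hset, measureReal_def, hunif]
    simp
  have hum : Measurable fun ω => u (J k ω) := (measurable_of_finite u).comp (hJ k)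
  have hAB : Integrable (fun ω => (A - B) (history J k ω)) P := integrable_comp_history hJ k _
  have hprod : Integrable (fun ω => (A - B) (history J k ω) * u (J k ω)) P := by
    refine hAB.mul_bdd (c := 1) hum.aestronglyMeasurable (Filter.Eventually.of_forall fun ω => ?_)
    simp only [hu]
    split_ifs <;> simp
  have hmul := hind.integral_fun_mul_eq_mul_integral hAB.aestronglyMeasurable
    hum.aestronglyMeasurable
  have hdiff : ∫ ω, (A - B) (history J k ω) ∂P = ∫ ω, a ω ∂P - ∫ ω, b ω ∂P := by
    rw [← integral_sub hai hbi]
    refine integral_congr_ae ?_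
    filter_upwards [hA, hB] with ω h1 h2
    rw [h1, h2, Pi.sub_apply]
  have : ∫ ω, (if i = J k ω then a ω else b ω) ∂P
      = ∫ ω, ((A - B) (history J k ω) * u (J k ω) + b ω) ∂P := by
    refine integral_congr_ae ?_
    filter_upwards [hA, hB] with ω h1 h2
    simp only [hu]
    split_ifs <;> simp [h1, h2]
  rw [this, integral_add hprod hbi, hmul, hui, hdiff]
  ring

/-- Linear convergence in expectation for randomly refreshed quantities. -/
theorem integral_refresh_le (hn : 1 ≤ n) (hJ : ∀ k, Measurable (J k)) (hindep : iIndepFun J P)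
    (hunif : ∀ k i, P {ω | J k ω = i} = (n : ℝ≥0∞)⁻¹) {e : ℕ → Ω → ℝ}
    {q : ℕ → Fin n → Ω → ℝ} {c d : ℝ} (hc : 0 ≤ c)
    (he : ∀ k, IsAdapted P J k (e k)) (hq : ∀ k i, IsAdapted P J k (q k i))
    (hq0 : ∀ i, q 0 i =ᵐ[P] fun _ => d)
    (hqs : ∀ k i, q (k + 1) i =ᵐ[P] fun ω => if i = J k ω then e k ω else q k i ω)
    (heq : ∀ k, ∀ᵐ ω ∂P, e k ω ≤ c * (1 / (n : ℝ) * ∑ i, q k i ω)) (k : ℕ) (i : Fin n) :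
    ∫ ω, q k i ω ∂P ≤ (1 / (n : ℝ) * c + (1 - 1 / (n : ℝ))) ^ k * d := by
  have hn' : (1 : ℝ) ≤ n := by exact_mod_cast hn
  have hn0 : (0 : ℝ) ≤ 1 - 1 / (n : ℝ) := sub_nonneg.2 ((div_le_one (by linarith)).2 hn')
  set r := 1 / (n : ℝ) * c + (1 - 1 / (n : ℝ)) with hr
  -- The bound is the same for all `i`, so it passes to the average that controls `e k`.
  induction k generalizing i with
  | zero => simp [integral_congr_ae (hq0 i)]
  | succ k ih =>
    have h1 : ∫ ω, e k ω ∂P ≤ c * (r ^ k * d) := by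
      calc ∫ ω, e k ω ∂P ≤ ∫ ω, c * (1 / (n : ℝ) * ∑ i, q k i ω) ∂P :=
            integral_mono_ae ((he k).integrable hJ)
              (((integrable_finsetSum _ fun i _ => (hq k i).integrable hJ).const_mul _).const_mul _)
              (heq k)
        _ = c * (1 / (n : ℝ) * ∑ i, ∫ ω, q k i ω ∂P) := by
            rw [integral_const_mul, integral_const_mul,
              integral_finsetSum _ fun i _ => (hq k i).integrable hJ]
        _ ≤ c * (1 / (n : ℝ) * ∑ _i : Fin n, r ^ k * d) := by
            gcongr with l
            exact ih l
        _ = c * (r ^ k * d) := by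
            have : (n : ℝ) ≠ 0 := by positivity
            rw [Finset.sum_const, Finset.card_univ, Fintype.card_fin, nsmul_eq_mul, ← mul_assoc,
              ← mul_assoc, mul_assoc c, one_div_mul_cancel this, mul_one]
    rw [integral_congr_ae (hqs k i), integral_ite_index hJ hindep hunif (he k) (hq k i)]
    calc _ ≤ 1 / (n : ℝ) * (c * (r ^ k * d)) + (1 - 1 / (n : ℝ)) * (r ^ k * d) := by
          gcongr
          exact ih i
      _ = r ^ (k + 1) * d := by rw [pow_succ, hr]; ring

/-- Markov's inequality, as a lower bound for the probability of the complementary event. -/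
theorem one_sub_le_measureReal_le {k : ℕ} (hJ : ∀ k, Measurable (J k)) {f : Ω → ℝ}
    (hf : IsAdapted P J k f) (hf0 : 0 ≤ f) {ε δ : ℝ} (hε : 0 < ε)
    (hint : ∫ ω, f ω ∂P ≤ δ * ε) : 1 - δ ≤ P.real {ω | f ω ≤ ε} := by
  have hfi := hf.integrable hJ
  have h1 := mul_meas_ge_le_integral_of_nonneg (Filter.Eventually.of_forall hf0) hfi ε
  have h2 : P.real {ω | f ω ≤ ε}ᶜ ≤ P.real {ω | ε ≤ f ω} :=
    measureReal_mono fun ω (hω : ¬f ω ≤ ε) => (not_le.1 hω).le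
  have h3 : ε * P.real {ω | f ω ≤ ε}ᶜ ≤ ε * δ := by
    calc _ ≤ ε * P.real {ω | ε ≤ f ω} := by gcongr
      _ ≤ _ := by linarith
  have h4 := le_of_mul_le_mul_left h3 hε
  -- Subadditivity suffices, so the event need not be measurable.
  have h5 := measureReal_union_le (μ := P) {ω | f ω ≤ ε} {ω | f ω ≤ ε}ᶜ
  rw [Set.union_compl_self, probReal_univ] at h5
  linarith

end History

end Proxtone

/-! ### Assembly -/

theorem corollary2 {p n : ℕ} (hn : 1 ≤ n)
    -- the objective and one of its minimizers
    (g : Fin n → EuclideanSpace ℝ (Fin p) → ℝ) (h : EuclideanSpace ℝ (Fin p) → EReal)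
    (x0 xstar : EuclideanSpace ℝ (Fin p))
    (L K : Fin n → ℝ) (m M μh Lmax Kavg ρ : ℝ)
    (hL : ∀ i, 0 < L i) (hK : ∀ i, 0 < K i) (hμh : 0 ≤ μh)
    (hLmax : Lmax = ⨆ i, L i) (hKavg : Kavg = 1 / (n : ℝ) * ∑ i, K i)
    (h_reg : Proxtone.IsRegularizer h)
    (h_sc : Proxtone.StronglyConvex h μh)
    (hg : ∀ i, Proxtone.IsSmoothLoss (g i) (Proxtone.effDom h) (L i) (K i))
    (hx0 : x0 ∈ Proxtone.effDom (Proxtone.objective g h))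
    (hxstar : IsMinOn (Proxtone.objective g h) Set.univ xstar)
    -- independent uniformly distributed indices
    {Ω : Type*} [MeasurableSpace Ω] (P : Measure Ω) [IsProbabilityMeasure P]
    (J : ℕ → Ω → Fin n) (hJ_meas : ∀ k, Measurable (J k)) (hJ_indep : iIndepFun J P)
    (hJ_unif : ∀ k i, P {ω | J k ω = i} = (n : ℝ≥0∞)⁻¹)
    -- the PROXTONE iterates, with exact Hessians as curvature operators
    (x : ℕ → Ω → EuclideanSpace ℝ (Fin p)) (θ : ℕ → Fin n → Ω → ℕ)
    (H : ℕ → Fin n → Ω → (EuclideanSpace ℝ (Fin p) →L[ℝ] EuclideanSpace ℝ (Fin p)))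
    (h_run : ∀ᵐ ω ∂P, Proxtone.IsRun g h x0 (fun k => J k ω) (fun k => x k ω)
      (fun k i => θ k i ω) (fun k i => H k i ω))
    (h_hess : ∀ᵐ ω ∂P, ∀ k i, H k i ω = Proxtone.hessian (g i) (x (θ k i ω) ω))
    (hLm : ∀ i, L i ≤ m)
    (h_lower : ∀ᵐ ω ∂P, ∀ k i,
      m • ContinuousLinearMap.id ℝ (EuclideanSpace ℝ (Fin p)) ≤ H k i ω)
    (h_upper : ∀ᵐ ω ∂P, ∀ k i,
      H k i ω ≤ M • ContinuousLinearMap.id ℝ (EuclideanSpace ℝ (Fin p)))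
    -- the rate, the accuracy, the confidence and the number of iterations
    (hρ : ρ = Proxtone.rate n Lmax M m μh) (hρ_lt : ρ < 1)
    (ε δ : ℝ) (hε : 0 < ε) (hδ : δ ∈ Set.Ioo (0 : ℝ) 1) (k : ℕ)
    (hk : Real.log
          (((Kavg + 2 * Lmax) * (M + Lmax) + 2 * Lmax * (2 * μh + m)) * ‖xstar - x0‖ ^ 2
            / (m * (2 * μh + m) * δ * ε))
        / Real.log (1 / ρ) ≤ (k : ℝ)) :
    1 - δ ≤ P.real {ω | ‖x (k + 1) ω - xstar‖ ≤ ε} := by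
  -- For `p = 0` the operator bounds say nothing about `m ≤ M`, which is needed below.
  rcases subsingleton_or_nontrivial (EuclideanSpace ℝ (Fin p)) with hE | hE
  · have : {ω | ‖x (k + 1) ω - xstar‖ ≤ ε} = Set.univ := by
      ext ω
      simp [Subsingleton.elim (x (k + 1) ω) xstar, hε.le]
    rw [this, probReal_univ]
    linarith [hδ.1]
  have hnpos : (0 : ℝ) < n := by exact_mod_cast hn
  let i0 : Fin n := ⟨0, hn⟩
  have hm : 0 < m := (hL i0).trans_le (hLm i0)
  have hLmax0 : 0 < Lmax := by
    rw [hLmax]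
    exact (hL i0).trans_le (le_ciSup (Set.finite_range L).bddAbove i0)
  have hK0 : 0 ≤ Kavg := by
    rw [hKavg]
    exact mul_nonneg (by positivity) (Finset.sum_nonneg fun i _ => (hK i).le)
  have h0 : x0 ∈ Proxtone.effDom h := by
    by_contra h1
    have h2 : h x0 = ⊤ := by simpa [Proxtone.effDom] using h1
    have h3 : Proxtone.objective g h x0 = ⊤ := by
      rw [Proxtone.objective, h2, EReal.coe_add_top]
    exact (show Proxtone.objective g h x0 < ⊤ from hx0).ne h3
  have hs : xstar ∈ Proxtone.effDom h := Proxtone.mem_effDom_of_isMinOn h0 hxstar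
  have hmM : m ≤ M := by
    obtain ⟨ω, h1, h2⟩ := (h_lower.and h_upper).exists
    obtain ⟨d, hd⟩ := exists_ne (0 : EuclideanSpace ℝ (Fin p))
    have h3 := (Proxtone.smul_norm_sq_le_inner (h1 0 i0) d).trans
      (Proxtone.inner_le_smul_norm_sq (h2 0 i0) d)
    exact le_of_mul_le_mul_right h3 (pow_pos (norm_pos_iff.2 hd) 2)
  set S : Set Ω := {ω | Proxtone.IsRun g h x0 (fun k => J k ω) (fun k => x k ω)
      (fun k i => θ k i ω) (fun k i => H k i ω) ∧
    (∀ k i, H k i ω = Proxtone.hessian (g i) (x (θ k i ω) ω)) ∧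
    (∀ k i, m • ContinuousLinearMap.id ℝ (EuclideanSpace ℝ (Fin p)) ≤ H k i ω) ∧
    ∀ k i, H k i ω ≤ M • ContinuousLinearMap.id ℝ (EuclideanSpace ℝ (Fin p))} with hSdef
  have hS : ∀ᵐ ω ∂P, ω ∈ S := by
    filter_upwards [h_run, h_hess, h_lower, h_upper] with ω h1 h2 h3 h4
    exact ⟨h1, h2, h3, h4⟩
  have hdet : ∀ k, ∀ ω ∈ S, ∀ ω' ∈ S, (∀ l < k, J l ω = J l ω') →
      (fun i => θ k i ω) = (fun i => θ k i ω') ∧ ∀ l ≤ k + 1, x l ω = x l ω' :=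
    fun k ω hω ω' hω' hj => Proxtone.IsRun.eq_of_indices_eq hn h_reg h_sc hμh hm h0 hω.1 hω'.1
      hω.2.1 hω'.2.1 hω.2.2.1 k hj
  -- The iterate `x (k + 1)` is computed before `J k` is used, so it depends only on draws before
  -- time `k`; this makes it independent of `J k`.
  have hnext : ∀ k, Proxtone.IsAdapted P J k fun ω => ‖x (k + 1) ω - xstar‖ := fun k =>
    Proxtone.isAdapted_of_determined hS fun ω hω ω' hω' hj => by
      simp only [(hdet k ω hω ω' hω' hj).2 (k + 1) le_rfl]
  have hbase : ∀ k i, Proxtone.IsAdapted P J k fun ω => ‖x (θ k i ω) ω - xstar‖ ^ 2 :=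
    fun k i => Proxtone.isAdapted_of_determined hS fun ω hω ω' hω' hj => by
      obtain ⟨h1, h2⟩ := hdet k ω hω ω' hω' hj
      have h3 : θ k i ω = θ k i ω' := congrFun h1 i
      simp only [← h3, h2 _ ((hω.1.theta_le k i).trans k.le_succ)]
  have hsum0 : 0 < 2 * μh + m := by linarith
  have hdecay := Proxtone.integral_refresh_le (P := P) (J := J) hn hJ_meas hJ_indep hJ_unif
    (e := fun k ω => ‖x (k + 1) ω - xstar‖ ^ 2)
    (q := fun k i ω => ‖x (θ k i ω) ω - xstar‖ ^ 2)
    (c := (M + Lmax) / (2 * μh + m)) (d := ‖xstar - x0‖ ^ 2)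
    (div_nonneg (by linarith) hsum0.le)
    (fun k => (hnext k).imp' (fun F a => F a ^ 2) fun F hF => hF.mono fun ω hω => by
      simp only [hω])
    hbase
    (fun i => hS.mono fun ω hω => by
      have h1 : x 0 ω = x0 := hω.1.start
      have h2 : θ 0 i ω = 0 := hω.1.theta_zero i
      simp only [h1, h2, norm_sub_rev x0])
    (fun k i => hS.mono fun ω hω => by
      have h1 : θ (k + 1) i ω = if i = J k ω then k + 1 else θ k i ω := hω.1.theta_succ k i
      simp only [h1]
      split_ifs <;> rfl)
    (fun k => hS.mono fun ω hω => by
      have h1 := Proxtone.norm_sq_step_le hn h_reg h_sc hg hLm (hω.2.2.1 k) (hω.2.2.2 k) hs hxstar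
        (fun i => hω.1.mem_effDom h0 _) (hω.1.mem_effDom h0 _) (hω.1.argmin k)
      have h2 : 0 ≤ 1 / (n : ℝ) * ∑ i, ‖x (θ k i ω) ω - xstar‖ ^ 2 := by positivity
      -- The one-step estimate has the constant `M`; adding this nonnegative term weakens it to `M +
      -- Lmax`.
      have h3 := mul_nonneg hLmax0.le h2
      rw [div_mul_eq_mul_div, le_div_iff₀ hsum0]
      linarith)
  have hρeq : 1 / (n : ℝ) * ((M + Lmax) / (2 * μh + m)) + (1 - 1 / (n : ℝ)) = ρ := hρ.symm
  rw [hρeq] at hdecay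
  have hρ0 : 0 < ρ := by
    have h1 : (1 : ℝ) ≤ n := by exact_mod_cast hn
    have h2 : (0 : ℝ) ≤ 1 - 1 / (n : ℝ) := sub_nonneg.2 ((div_le_one hnpos).2 h1)
    have h3 : 0 < 1 / (n : ℝ) * ((M + Lmax) / (2 * μh + m)) := by
      have : 0 < M + Lmax := by linarith
      positivity
    rw [← hρeq]
    linarith
  set B := (Kavg + 2 * Lmax) * (M + Lmax) + 2 * Lmax * (2 * μh + m) with hB
  have hexp : ∫ ω, ‖x (k + 1) ω - xstar‖ ∂P
      ≤ B * ‖xstar - x0‖ ^ 2 / (m * (2 * μh + m)) * ρ ^ k := by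
    have h1 : (m + μh) * ∫ ω, ‖x (k + 1) ω - xstar‖ ∂P
        ≤ Kavg / 2 * (ρ ^ k * ‖xstar - x0‖ ^ 2) := by
      have hint : ∀ i, Integrable (fun ω => K i / 2 * ‖x (θ k i ω) ω - xstar‖ ^ 2) P :=
        fun i => ((hbase k i).integrable hJ_meas).const_mul _
      calc (m + μh) * ∫ ω, ‖x (k + 1) ω - xstar‖ ∂P
          = ∫ ω, (m + μh) * ‖x (k + 1) ω - xstar‖ ∂P := (integral_const_mul _ _).symm
        _ ≤ ∫ ω, 1 / (n : ℝ) * ∑ i, K i / 2 * ‖x (θ k i ω) ω - xstar‖ ^ 2 ∂P :=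
            integral_mono_ae (((hnext k).integrable hJ_meas).const_mul _)
              ((integrable_finsetSum _ fun i _ => hint i).const_mul _)
              (hS.mono fun ω hω => Proxtone.norm_step_le hn h_reg h_sc hg (hω.2.1 k) (hω.2.2.1 k)
                hs hxstar (fun i => hω.1.mem_effDom h0 _) (hω.1.mem_effDom h0 _) (hω.1.argmin k))
        _ = 1 / (n : ℝ) * ∑ i, K i / 2 * ∫ ω, ‖x (θ k i ω) ω - xstar‖ ^ 2 ∂P := by
            rw [integral_const_mul, integral_finsetSum _ fun i _ => hint i]
            simp only [integral_const_mul]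
        _ ≤ 1 / (n : ℝ) * ∑ i, K i / 2 * (ρ ^ k * ‖xstar - x0‖ ^ 2) := by
            gcongr with i
            · exact (half_pos (hK i)).le
            · exact hdecay k i
        _ = Kavg / 2 * (ρ ^ k * ‖xstar - x0‖ ^ 2) := by
            rw [hKavg, ← Finset.sum_mul, ← Finset.sum_div]
            ring
    -- The summand `Kavg * (M + Lmax)` of `B` is already enough, since `m ≤ M + Lmax` and `2 * μh +
    -- m ≤ 2 * (m + μh)`; the rest of `B` is slack.
    have h2 : Kavg / 2 * (m * (2 * μh + m)) ≤ B * (m + μh) := by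
      have a : m * (2 * μh + m) ≤ 2 * ((M + Lmax) * (m + μh)) := by nlinarith
      have b : 0 ≤ Lmax * (M + Lmax) * (m + μh) := by
        have : 0 < M + Lmax := by linarith
        positivity
      have c : 0 ≤ Lmax * (2 * μh + m) * (m + μh) := by positivity
      rw [hB]
      nlinarith [mul_le_mul_of_nonneg_left a hK0]
    have h3 : 0 ≤ ρ ^ k * ‖xstar - x0‖ ^ 2 := by positivity
    rw [div_mul_eq_mul_div, le_div_iff₀ (by positivity)]
    have hmμ : 0 < m + μh := by linarith
    refine le_of_mul_le_mul_left ?_ hmμ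
    calc (m + μh) * ((∫ ω, ‖x (k + 1) ω - xstar‖ ∂P) * (m * (2 * μh + m)))
        = (m + μh) * (∫ ω, ‖x (k + 1) ω - xstar‖ ∂P) * (m * (2 * μh + m)) := by ring
      _ ≤ Kavg / 2 * (ρ ^ k * ‖xstar - x0‖ ^ 2) * (m * (2 * μh + m)) := by gcongr
      _ = Kavg / 2 * (m * (2 * μh + m)) * (ρ ^ k * ‖xstar - x0‖ ^ 2) := by ring
      _ ≤ B * (m + μh) * (ρ ^ k * ‖xstar - x0‖ ^ 2) := by gcongr
      _ = (m + μh) * (B * ‖xstar - x0‖ ^ 2 * ρ ^ k) := by ring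
  refine Proxtone.one_sub_le_measureReal_le hJ_meas (hnext k) (fun ω => norm_nonneg _) hε
    (hexp.trans ?_)
  set Q := B * ‖xstar - x0‖ ^ 2 / (m * (2 * μh + m) * δ * ε) with hQ
  have hQk : Q ≤ (1 / ρ) ^ k := by
    -- The case `Q ≤ 0` covers `xstar = x0`, where the logarithm in `hk` carries no information.
    rcases le_or_gt Q 0 with h1 | h1
    · exact h1.trans (by positivity)
    · have h2 : 0 < Real.log (1 / ρ) := Real.log_pos ((one_lt_div hρ0).2 hρ_lt)
      rw [div_le_iff₀ h2, ← Real.log_pow] at hk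
      exact (Real.log_le_log_iff h1 (by positivity)).1 hk
  have hδ0 := hδ.1
  calc B * ‖xstar - x0‖ ^ 2 / (m * (2 * μh + m)) * ρ ^ k
      = Q * ρ ^ k * (δ * ε) := by rw [hQ]; field_simp
    _ ≤ (1 / ρ) ^ k * ρ ^ k * (δ * ε) := by gcongr
    _ = δ * ε := by rw [← mul_pow, one_div_mul_cancel hρ0.ne', one_pow, one_mul]
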